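/- Let $F$ be a field of characteristic $0$ and let $A = M_2(F)\oplus \mathrm{UT}_2(F)$ (direct sum of ideals), where $M_2(F)$ is the algebra of $2\times 2$ matrices and $\mathrm{UT}_2(F)$ is the algebra of upper triangular $2\times 2$ matrices over $F$. Let $T_1=\{0,1\}$ be the multiplicative semigroup of the field $\mathbb Z/2\mathbb Z$, and grade $A = A^{(0)}\oplus A^{(1)}$ by $T_1$ by setting $A^{(0)}=(M_2(F),0)$ and $A^{(1)}=\{(\varphi(a),a) \mid a\in \mathrm{UT}_2(F)\}$, where $\varphi\colon \mathrm{UT}_2(F)\hookrightarrow M_2(F)$ is the inclusion. For a $T$-graded algebra $A=\bigoplus_{t\in T}A^{(t)}$ over $F$, where $T$ is a semigroup, let $F\langle X^{T\text{-}\mathrm{gr}}\rangle$ be the free associative algebra over $F$ on the non-commuting variables $x^{(t)}_i$ ($t\in T$, $i\in\mathbb N$), let $\mathrm{Id}^{T\text{-}\mathrm{gr}}(A)$ be the set of polynomials in it that vanish under all substitutions of elements of $A^{(t)}$ for the variables $x_i^{(t)}$, let $$P_n^{T\text{-}\mathrm{gr}}=\left\langle x^{(t_1)}_{\sigma(1)}x^{(t_2)}_{\sigma(2)}\cdots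 x^{(t_n)}_{\sigma(n)} \mid t_i\in T,\ \sigma\in S_n\right\rangle_F,$$ and let the $n$th graded codimension of $A$ be $$c_n^{T\text{-}\mathrm{gr}}(A)=\dim_F \frac{P_n^{T\text{-}\mathrm{gr}}}{P_n^{T\text{-}\mathrm{gr}}\cap \mathrm{Id}^{T\text{-}\mathrm{gr}}(A)}.$$ Then for the graded algebra $A = M_2(F)\oplus \mathrm{UT}_2(F)$ above, the limit $\lim_{n\to\infty}\sqrt[n]{c_n^{T_1\text{-}\mathrm{gr}}(A)}$ exists and equals $4+2\sqrt 2$. -/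

import Mathlib

open Filter Topology

/-- A grading of the (associative, not necessarily unital) `F`-algebra `A` by the semigroup `T`:
a decomposition `A = ⨁ t, A^(t)` into subspaces with `A^(h) A^(t) ⊆ A^(h t)`. -/
structure SemigroupGrading (F T A : Type*) [Field F] [Semigroup T] [DecidableEq T]
    [NonUnitalRing A] [Module F A] where
  component : T → Submodule F A
  isInternal : DirectSum.IsInternal component
  mul_mem : ∀ (h t : T) (a b : A), a ∈ component h → b ∈ component t → a * b ∈ component (h * t)

/-- The free `T`-graded associative algebra `F⟨X^{T-gr}⟩` (without constant terms) on the variables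
`x^{(t)}_i = (t, i)`, `t ∈ T`, `i ∈ ℕ`: the semigroup algebra of the free semigroup of nonempty
words in the variables. -/
abbrev FreeGradedAlgebra (F T : Type*) [Field F] : Type _ :=
  MonoidAlgebra F (FreeSemigroup (T × ℕ))

/-- The subspace `P_n^{T-gr}` of multilinear polynomials, spanned by the monomials
`x^{(t_1)}_{σ(1)} ⋯ x^{(t_n)}_{σ(n)}` with `t_i ∈ T` and `σ ∈ S_n`. The list of letters of a word
`w` is `w.head :: w.tail`. -/
noncomputable def multilinearGraded (F T : Type*) [Field F] (n : ℕ) :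
    Submodule F (FreeGradedAlgebra F T) :=
  Submodule.span F
    {f | ∃ (t : Fin n → T) (σ : Equiv.Perm (Fin n)) (w : FreeSemigroup (T × ℕ)),
      w.head :: w.tail = List.ofFn (fun i => (t i, (σ i : ℕ))) ∧
      f = MonoidAlgebra.single w (1 : F)}

/-- The value of a polynomial under the substitution `v` of elements of `A` for the variables. -/
noncomputable def gradedEval {F T A : Type*} [Field F] [NonUnitalRing A] [Module F A]
    [IsScalarTower F A A] [SMulCommClass F A A] (v : T × ℕ → A) :
    FreeGradedAlgebra F T →ₙₐ[F] A :=
  MonoidAlgebra.liftMagma F (FreeSemigroup.lift v)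

section
variable {F T A : Type*} [Field F] [Semigroup T] [DecidableEq T]
  [NonUnitalRing A] [Module F A] [IsScalarTower F A A] [SMulCommClass F A A]

/-- The space `Id^{T-gr}(A)` of graded polynomial identities: those `f` that vanish whenever each
variable `x^{(t)}_i` is replaced by an element of `A^(t)`. -/
def gradedIdentities (Γ : SemigroupGrading F T A) : Submodule F (FreeGradedAlgebra F T) where
  carrier := {f | ∀ v : T × ℕ → A, (∀ t i, v (t, i) ∈ Γ.component t) → gradedEval v f = 0}
  zero_mem' := fun v _ => map_zero (gradedEval v)
  add_mem' := by
    intro f g hf hg v hv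
    rw [map_add, hf v hv, hg v hv, add_zero]
  smul_mem' := by
    intro c f hf v hv
    rw [map_smul, hf v hv, smul_zero]

/-- The `n`-th graded codimension `dim (P_n^{T-gr} / (P_n^{T-gr} ∩ Id^{T-gr}(A)))`. -/
noncomputable def gradedCodim (Γ : SemigroupGrading F T A) (n : ℕ) : ℕ :=
  Module.finrank F
    (multilinearGraded F T n ⧸
      (multilinearGraded F T n ⊓ gradedIdentities Γ).submoduleOf (multilinearGraded F T n))

end

/-- The algebra `UT_k(F)` of upper triangular matrices. -/
def upperTriangular (F : Type*) [Field F] (k : ℕ) : Subalgebra F (Matrix (Fin k) (Fin k) F) where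
  carrier := {M | M.IsUpperTriangular}
  mul_mem' := fun ha hb => Matrix.BlockTriangular.mul ha hb
  add_mem' := fun ha hb => Matrix.BlockTriangular.add ha hb
  algebraMap_mem' := by
    intro c i j hij
    exact Matrix.algebraMap_matrix_apply.trans (if_neg (ne_of_gt hij))

/-- The algebra `M_k(F) ⊕ UT_k(F)` with componentwise operations. -/
abbrev MatrixSumUT (F : Type*) [Field F] (k : ℕ) : Type _ :=
  Matrix (Fin k) (Fin k) F × upperTriangular F k

/-- The subspace `(M_k(F), 0)`. -/
def matrixPart (F : Type*) [Field F] (k : ℕ) : Submodule F (MatrixSumUT F k) :=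
  LinearMap.range (LinearMap.inl F (Matrix (Fin k) (Fin k) F) (upperTriangular F k))

/-- The subspace `{(φ(a), a) | a ∈ UT_k(F)}`, with `φ` the inclusion `UT_k(F) → M_k(F)`. -/
def graphPart (F : Type*) [Field F] (k : ℕ) : Submodule F (MatrixSumUT F k) :=
  LinearMap.range ((upperTriangular F k).val.toLinearMap.prod LinearMap.id)

theorem mem_matrixPart {F : Type*} [Field F] {k : ℕ} {x : MatrixSumUT F k} :
    x ∈ matrixPart F k ↔ x.2 = 0 := by
  constructor
  · rintro ⟨a, rfl⟩
    rfl
  · intro h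
    exact ⟨x.1, Prod.ext rfl h.symm⟩

theorem mem_graphPart {F : Type*} [Field F] {k : ℕ} {x : MatrixSumUT F k} :
    x ∈ graphPart F k ↔ x.1 = (x.2 : Matrix (Fin k) (Fin k) F) := by
  constructor
  · rintro ⟨a, rfl⟩
    rfl
  · intro h
    exact ⟨x.2, Prod.ext h.symm rfl⟩

/-- The grading of `M_k(F) ⊕ UT_k(F)` by the multiplicative semigroup `T_1 = {0, 1}` of the field
`ℤ/2ℤ`, with `A^(0) = (M_k(F), 0)` and `A^(1) = {(φ(a), a) | a ∈ UT_k(F)}`. -/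
def t1Grading (F : Type*) [Field F] (k : ℕ) :
    SemigroupGrading F (ZMod 2) (MatrixSumUT F k) where
  component := fun t => if t = 0 then matrixPart F k else graphPart F k
  isInternal := by
    have h01 : (0 : ZMod 2) ≠ 1 := by decide
    have huniv : (Set.univ : Set (ZMod 2)) = {0, 1} := by
      have h : ∀ t : ZMod 2, t = 0 ∨ t = 1 := by decide
      ext t
      simpa using h t
    rw [DirectSum.isInternal_submodule_iff_isCompl _ h01 huniv]
    simp only [if_true, if_neg h01.symm]
    constructor
    · rw [Submodule.disjoint_def]
      intro x h0 h1
      rw [mem_matrixPart] at h0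
      rw [mem_graphPart, h0] at h1
      exact Prod.ext h1 h0
    · rw [codisjoint_iff, Submodule.eq_top_iff']
      intro x
      rw [Submodule.mem_sup]
      refine ⟨(x.1 - (x.2 : Matrix (Fin k) (Fin k) F), 0), mem_matrixPart.2 rfl,
        ((x.2 : Matrix (Fin k) (Fin k) F), x.2), mem_graphPart.2 rfl, ?_⟩
      exact Prod.ext (sub_add_cancel _ _) (zero_add _)
  mul_mem := by
    intro h t a b ha hb
    by_cases hh : h = 0
    · simp only [hh, zero_mul, if_true, mem_matrixPart] at ha ⊢
      rw [Prod.snd_mul, ha, zero_mul]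
    by_cases ht : t = 0
    · simp only [ht, mul_zero, if_true, mem_matrixPart] at hb ⊢
      rw [Prod.snd_mul, hb, mul_zero]
    have hht : h * t ≠ 0 := mul_ne_zero hh ht
    simp only [if_neg hh, if_neg ht, if_neg hht, mem_graphPart] at ha hb ⊢
    rw [Prod.fst_mul, Prod.snd_mul, ha, hb]
    rfl

/-! ### Evaluation of multilinear graded polynomials -/

section Evaluation

variable {F T A B : Type*} [Field F]

/-! Projecting to the first coordinate turns the graded identities into those of M_2(F) with the
degree 1 variables restricted to upper triangular matrices. By multilinearity only seven values per
index matter: four matrix units of degree 0 and three of degree 1. Give e_{pq} the weight p - q,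
with p, q in {0, 1}: four units have weight 0, two have weight -1, one has weight 1.

Upper bound: a nonzero entry of a value forces total weight -1, 0 or 1, so the codimension is at
most four times the number of such tuples. Their number is controlled by the generating function 4 +
2/z + z, whose minimum over z > 0 is 4 + 2√2, at z = √2.

Lower bound: consider tuples whose letters can be arranged in a word along which the units compose
from index 1 to index 0, passing through 0 at ascents and through 1 at descents. Among the tuples
giving the monomial of this word a nonzero (1, 0) entry, the given one is the unique maximizer of
`tuplePotential`; hence the monomials are independent modulo identities
(`gradedEval_listMonomial_triangular`). Building words by inserting letters in increasing order,
with h + 1 partial words at a time, gives the recurrence of a weighted walk on h ≥ 0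
(`ncard_fragmentTuples_succ`). Its truncation to h ≤ K has a sine eigenvector with eigenvalue 4 +
2√2 cos(π/(K+2)), which tends to 4 + 2√2. -/

theorem gradedEval_single [Ring A] [Algebra F A] (v : T × ℕ → A) (w : FreeSemigroup (T × ℕ)) :
    gradedEval v (MonoidAlgebra.single w (1 : F)) = ((w.head :: w.tail).map v).prod := by
  have h1 : gradedEval v (MonoidAlgebra.single w (1 : F)) = FreeSemigroup.lift v w := by
    have := DFunLike.congr_fun ((MonoidAlgebra.liftMagma F).symm_apply_apply (FreeSemigroup.lift v)) w
    exact this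
  rw [h1]
  clear h1
  obtain ⟨x, l⟩ := w
  rw [FreeSemigroup.lift_mk_eq_foldl, List.map_cons, List.prod_cons]
  generalize v x = a
  induction l generalizing a with
  | nil => simp
  | cons y l ih => simp [ih, mul_assoc]

theorem map_gradedEval [NonUnitalRing A] [Module F A] [IsScalarTower F A A] [SMulCommClass F A A]
    [NonUnitalRing B] [Module F B] [IsScalarTower F B B] [SMulCommClass F B B]
    (φ : A →ₙₐ[F] B) (v : T × ℕ → A) (f : FreeGradedAlgebra F T) :
    φ (gradedEval v f) = gradedEval (fun x => φ (v x)) f := by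
  have h : φ.comp (gradedEval v) = gradedEval (fun x => φ (v x)) := by
    apply MonoidAlgebra.nonUnitalAlgHom_ext'
    apply FreeSemigroup.hom_ext
    funext x
    have h1 : gradedEval (F := F) v (MonoidAlgebra.single (FreeSemigroup.of x) 1) = v x :=
      DFunLike.congr_fun ((MonoidAlgebra.liftMagma F).symm_apply_apply (FreeSemigroup.lift v))
        (FreeSemigroup.of x)
    have h2 : gradedEval (F := F) (fun x => φ (v x))
        (MonoidAlgebra.single (FreeSemigroup.of x) 1) = φ (v x) :=
      DFunLike.congr_fun ((MonoidAlgebra.liftMagma F).symm_apply_apply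
        (FreeSemigroup.lift (fun x => φ (v x)))) (FreeSemigroup.of x)
    exact (congrArg φ h1).trans h2.symm
  exact DFunLike.congr_fun h f

/-- Each monomial contains exactly one variable of index i, of some degree. So the slot i must carry
all the values t ↦ v (t, i) at once for monomials of different degree patterns to add up to one
multilinear map. -/
theorem exists_multilinearMap_gradedEval [Ring A] [Algebra F A] {n : ℕ}
    {f : FreeGradedAlgebra F T} (hf : f ∈ multilinearGraded F T n) :
    ∃ M : MultilinearMap F (fun _ : Fin n => T → A) A,
      ∀ v : T × ℕ → A, gradedEval v f = M (fun i t => v (t, i)) := by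
  induction hf using Submodule.span_induction with
  | mem f hf =>
    obtain ⟨t, σ, w, hw, rfl⟩ := hf
    refine ⟨((MultilinearMap.mkPiAlgebraFin F n A).compLinearMap
      (fun i => LinearMap.proj (t i))).domDomCongr σ, fun v => ?_⟩
    rw [gradedEval_single, hw, List.map_ofFn]
    rfl
  | zero => exact ⟨0, fun v => by simp⟩
  | add f g _ _ hf hg =>
    obtain ⟨M, hM⟩ := hf
    obtain ⟨N, hN⟩ := hg
    exact ⟨M + N, fun v => by simp [hM, hN]⟩
  | smul c f _ hf =>
    obtain ⟨M, hM⟩ := hf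
    exact ⟨c • M, fun v => by simp [hM]⟩

theorem single_mem_multilinearGraded {n : ℕ} (l : List (Fin n)) (hl : l.Perm (List.finRange n))
    (t : Fin n → T) (w : FreeSemigroup (T × ℕ))
    (hw : w.head :: w.tail = l.map (fun i => (t i, (i : ℕ)))) :
    MonoidAlgebra.single w (1 : F) ∈ multilinearGraded F T n := by
  have hlen : l.length = n := by simpa using hl.length_eq
  have hnd : l.Nodup := hl.nodup_iff.2 (List.nodup_finRange n)
  have hinj : Function.Injective (fun i : Fin n => l.get (i.cast hlen.symm)) := by
    intro i j hij
    have := List.nodup_iff_injective_get.1 hnd hij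
    simpa [Fin.ext_iff] using this
  have hbij := Finite.injective_iff_bijective.1 hinj
  refine Submodule.subset_span ⟨fun i => t (l.get (i.cast hlen.symm)), Equiv.ofBijective _ hbij, w, ?_, rfl⟩
  rw [hw]
  apply List.ext_getElem
  · simp [hlen]
  · intro i h1 h2
    simp

end Evaluation

/-! ### Reduction to substitutions in the full matrix algebra -/

section Identities

variable {F : Type*} [Field F]

theorem mem_gradedIdentities_t1Grading {k : ℕ} {f : FreeGradedAlgebra F (ZMod 2)} :
    f ∈ gradedIdentities (t1Grading F k) ↔
      ∀ v : ZMod 2 × ℕ → Matrix (Fin k) (Fin k) F,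
        (∀ i, v (1, i) ∈ upperTriangular F k) → gradedEval v f = 0 := by
  have h01 : (1 : ZMod 2) ≠ 0 := by decide
  have hz : ∀ t : ZMod 2, t ≠ 0 → t = 1 := by decide
  constructor
  · intro hf v hv
    let u : ZMod 2 × ℕ → MatrixSumUT F k := fun x =>
      if x.1 = 0 then (v x, 0) else (v (1, x.2), ⟨v (1, x.2), hv x.2⟩)
    have hu := hf u (by
      intro t i
      by_cases ht : t = 0
      · simp [u, ht, t1Grading, mem_matrixPart]
      · simp [u, ht, t1Grading, mem_graphPart])
    have h := map_gradedEval (NonUnitalAlgHom.fst F _ _) u f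
    rw [hu, map_zero] at h
    rw [h]
    congr 2
    funext ⟨t, i⟩
    by_cases ht : t = 0
    · simp [u, ht]
    · simp [u, hz t ht]
  · intro hf v hv
    have h1 : ∀ t i, t ≠ 0 → (v (t, i)).1 = ((v (t, i)).2 : Matrix (Fin k) (Fin k) F) := by
      intro t i ht
      have := hv t i
      simp only [t1Grading, if_neg ht, mem_graphPart] at this
      exact this
    have h0 : ∀ i, (v (0, i)).2 = 0 := by
      intro i
      have := hv 0 i
      simpa only [t1Grading, if_true, mem_matrixPart] using this
    apply Prod.ext
    · refine (map_gradedEval (NonUnitalAlgHom.fst F _ _) v f).trans (hf _ fun i => ?_)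
      show (v (1, i)).1 ∈ _
      rw [h1 1 i h01]
      exact (v (1, i)).2.2
    · apply Subtype.ext
      -- The second coordinate is again an admissible substitution in the matrix algebra: zero in
      -- degree 0 and upper triangular in degree 1.
      let ψ : upperTriangular F k →ₙₐ[F] Matrix (Fin k) (Fin k) F :=
        ((upperTriangular F k).val : upperTriangular F k →ₐ[F] _)
      have h := map_gradedEval (ψ.comp (NonUnitalAlgHom.snd F _ _)) v f
      refine h.trans (hf _ fun i => ?_)
      exact (v (1, i)).2.2

end Identities

/-! ### Matrix units and their weights -/

section Letters

/-- Matrix units of the homogeneous components of `t1Grading F 2`: the triple `(t, p, q)` stands for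
the element of the component of degree `t` with first coordinate the matrix unit `e_{pq}`. -/
abbrev GradedUnit : Type := {x : ZMod 2 × Fin 2 × Fin 2 // x.1 = 0 ∨ x.2.1 ≤ x.2.2}

namespace GradedUnit

/-- The degree. -/
def deg (x : GradedUnit) : ZMod 2 := x.1.1

/-- The row index. -/
def row (x : GradedUnit) : Fin 2 := x.1.2.1

/-- The column index. -/
def col (x : GradedUnit) : Fin 2 := x.1.2.2

theorem ext_iff' {x y : GradedUnit} : x = y ↔ x.deg = y.deg ∧ x.row = y.row ∧ x.col = y.col := by
  rw [Subtype.ext_iff, Prod.ext_iff, Prod.ext_iff]; rfl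

/-- The weight under conjugation by diagonal matrices. -/
def weight (x : GradedUnit) : ℤ := (x.row : ℕ) - (x.col : ℕ)

theorem sum_eq {M : Type*} [AddCommMonoid M] (f : ZMod 2 → Fin 2 → Fin 2 → M) :
    ∑ x : GradedUnit, f x.deg x.row x.col =
      f 0 0 0 + f 0 0 1 + f 0 1 0 + f 0 1 1 + f 1 0 0 + f 1 0 1 + f 1 1 1 := by
  have h := Finset.sum_subtype (F := inferInstance) (Finset.univ.filter
    fun x : ZMod 2 × Fin 2 × Fin 2 => x.1 = 0 ∨ x.2.1 ≤ x.2.2) (p := fun x => x.1 = 0 ∨ x.2.1 ≤ x.2.2)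
    (by simp) (fun x => f x.1 x.2.1 x.2.2)
  refine h.symm.trans ?_
  have hs : (Finset.univ.filter
      fun x : ZMod 2 × Fin 2 × Fin 2 => x.1 = 0 ∨ x.2.1 ≤ x.2.2) =
      {(0, 0, 0), (0, 0, 1), (0, 1, 0), (0, 1, 1), (1, 0, 0), (1, 0, 1), (1, 1, 1)} := by decide
  rw [hs]
  repeat rw [Finset.sum_insert (by decide)]
  rw [Finset.sum_singleton]
  simp only [add_assoc]

end GradedUnit

variable (F : Type*) [Field F]

/-- The substitution of `e_{pq}` for the `i`th variable of degree `t`, where `r i = (t, p, q)`, and of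
zero for all other variables. -/
def unitSubst {n : ℕ} (r : Fin n → GradedUnit) (x : ZMod 2 × ℕ) : Matrix (Fin 2) (Fin 2) F :=
  if h : x.2 < n then
    if (r ⟨x.2, h⟩).deg = x.1 then Matrix.single (r ⟨x.2, h⟩).row (r ⟨x.2, h⟩).col 1 else 0
  else 0

variable {F}

theorem unitSubst_fin {n : ℕ} (r : Fin n → GradedUnit) (t : ZMod 2) (i : Fin n) :
    unitSubst F r (t, i) = if (r i).deg = t then Matrix.single (r i).row (r i).col 1 else 0 := by
  simp [unitSubst]

theorem unitSubst_mem {n : ℕ} (r : Fin n → GradedUnit) (i : ℕ) :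
    unitSubst F r (1, i) ∈ upperTriangular F 2 := by
  show Matrix.BlockTriangular _ id
  intro p q hpq
  unfold unitSubst
  dsimp only
  split_ifs with h h1
  · rw [Matrix.single_apply, if_neg]
    rintro ⟨hp, hq⟩
    rcases (r ⟨i, h⟩).2 with h0 | h0
    · exact absurd (h0.symm.trans h1) (by decide)
    · change (r ⟨i, h⟩).row ≤ (r ⟨i, h⟩).col at h0
      rw [hp, hq] at h0
      exact absurd hpq (not_lt.2 h0)
  · rfl
  · rfl

theorem mem_gradedIdentities_of_unitSubst {n : ℕ} {f : FreeGradedAlgebra F (ZMod 2)}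
    (hf : f ∈ multilinearGraded F (ZMod 2) n)
    (h : ∀ r : Fin n → GradedUnit, gradedEval (unitSubst F r) f = 0) :
    f ∈ gradedIdentities (t1Grading F 2) := by
  rw [mem_gradedIdentities_t1Grading]
  intro v hv
  obtain ⟨M, hM⟩ := exists_multilinearMap_gradedEval (A := Matrix (Fin 2) (Fin 2) F) hf
  let e : GradedUnit → ZMod 2 → Matrix (Fin 2) (Fin 2) F :=
    fun x t => if x.deg = t then Matrix.single x.row x.col 1 else 0
  have hz : ∀ t : ZMod 2, t = 0 ∨ t = 1 := by decide
  have hexp : (fun (i : Fin n) t => v (t, (i : ℕ))) =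
      fun (i : Fin n) => ∑ x : GradedUnit, v (x.deg, (i : ℕ)) x.row x.col • e x := by
    funext i
    rw [GradedUnit.sum_eq (fun t p q => v (t, (i : ℕ)) p q •
      (fun s : ZMod 2 => if t = s then (Matrix.single p q 1 : Matrix (Fin 2) (Fin 2) F) else 0))]
    -- This removes the one matrix unit that `GradedUnit` lacks.
    have hlow : v (1, (i : ℕ)) 1 0 = 0 := hv i (show (0 : Fin 2) < 1 by decide)
    funext t
    ext p q
    rcases hz t with rfl | rfl <;> fin_cases p <;> fin_cases q <;>
      simp [hlow]
  rw [hM, hexp, MultilinearMap.map_sum]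
  refine Finset.sum_eq_zero fun r _ => ?_
  rw [MultilinearMap.map_smul_univ]
  have := h r
  rw [hM] at this
  simp only [unitSubst_fin] at this
  change _ • M (fun i => e (r i)) = 0
  rw [show (fun i => e (r i)) = fun (i : Fin n) (t : ZMod 2) =>
    if (r i).deg = t then (Matrix.single (r i).row (r i).col 1 : Matrix (Fin 2) (Fin 2) F) else 0 from rfl,
    this, smul_zero]

/-- A nonzero (p, q) entry comes from a path of indices from p to q, along which the weights
telescope. -/
theorem sum_eq_of_list_prod_ne_zero {ι : Type*} (w : ι → ℤ) (X : ι → Matrix (Fin 2) (Fin 2) F)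
    (hX : ∀ i p q, X i p q ≠ 0 → w i = (p : ℕ) - (q : ℕ)) (l : List ι) (p q : Fin 2)
    (h : (l.map X).prod p q ≠ 0) : (l.map w).sum = (p : ℕ) - (q : ℕ) := by
  induction l generalizing p with
  | nil =>
    have : p = q := by
      by_contra hpq
      exact h (by simp [hpq])
    simp [this]
  | cons i l ih =>
    rw [List.map_cons, List.prod_cons, Matrix.mul_apply] at h
    obtain ⟨m, -, hm⟩ := Finset.exists_ne_zero_of_sum_ne_zero h
    rw [List.map_cons, List.sum_cons, ih m (right_ne_zero_of_mul hm), hX i p m (left_ne_zero_of_mul hm)]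
    ring

theorem gradedEval_unitSubst_eq_zero {n : ℕ} {f : FreeGradedAlgebra F (ZMod 2)}
    (hf : f ∈ multilinearGraded F (ZMod 2) n) (r : Fin n → GradedUnit) {p q : Fin 2}
    (h : ∑ i, (r i).weight ≠ (p : ℕ) - (q : ℕ)) : gradedEval (unitSubst F r) f p q = 0 := by
  induction hf using Submodule.span_induction with
  | mem f hf =>
    obtain ⟨t, σ, w, hw, rfl⟩ := hf
    by_contra hne
    rw [gradedEval_single, hw, List.map_ofFn, List.ofFn_eq_map] at hne
    have := sum_eq_of_list_prod_ne_zero (fun i => (r (σ i)).weight) _ ?_ _ p q hne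
    · apply h
      rw [← this, ← List.ofFn_eq_map, List.sum_ofFn]
      exact (Equiv.sum_comp σ (fun i => (r i).weight)).symm
    · intro i a b hab
      simp only [Function.comp, unitSubst_fin] at hab
      split_ifs at hab with h1
      · rw [Matrix.single_apply] at hab
        split_ifs at hab with h2
        · rw [GradedUnit.weight, h2.1, h2.2]
        · exact absurd rfl hab
      · exact absurd rfl hab
  | zero => simp
  | add f g _ _ hf hg => simp [hf, hg]
  | smul c f _ hf => simp [hf]

end Letters

/-! ### Upper bound by counting balanced tuples -/

section UpperBound

variable (F : Type*) [Field F]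

/-- The relations of degree `n` in the definition of the graded codimension. -/
noncomputable abbrev gradedRelations (n : ℕ) : Submodule F (multilinearGraded F (ZMod 2) n) :=
  (multilinearGraded F (ZMod 2) n ⊓ gradedIdentities (t1Grading F 2)).submoduleOf
    (multilinearGraded F (ZMod 2) n)

/-- Tuples of matrix units of total weight between `-1` and `1`. -/
def balancedTuples (n : ℕ) : Finset (Fin n → GradedUnit) :=
  Finset.univ.filter fun r => ∑ i, (r i).weight ≤ 1 ∧ -1 ≤ ∑ i, (r i).weight

/-- Evaluation of multilinear polynomials at balanced tuples of matrix units. -/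
noncomputable def balancedEval (n : ℕ) :
    multilinearGraded F (ZMod 2) n →ₗ[F] (balancedTuples n × Fin 2 × Fin 2 → F) where
  toFun f x := gradedEval (unitSubst F x.1.1) f.1 x.2.1 x.2.2
  map_add' f g := by ext x; simp
  map_smul' c f := by ext x; simp

variable {F}

theorem ker_balancedEval_le (n : ℕ) : LinearMap.ker (balancedEval F n) ≤ gradedRelations F n := by
  intro f hf
  refine Submodule.mem_comap.2 ⟨f.2, mem_gradedIdentities_of_unitSubst f.2 fun r => ?_⟩
  ext p q
  by_cases hr : ∑ i, (r i).weight = (p : ℕ) - (q : ℕ)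
  · have hb : r ∈ balancedTuples n := by
      rw [balancedTuples, Finset.mem_filter, hr]
      have := p.2
      have := q.2
      exact ⟨Finset.mem_univ _, by omega, by omega⟩
    exact congrFun (LinearMap.mem_ker.1 hf) (⟨r, hb⟩, p, q)
  · exact gradedEval_unitSubst_eq_zero f.2 r hr

instance (n : ℕ) : Module.Finite F
    (multilinearGraded F (ZMod 2) n ⧸ LinearMap.ker (balancedEval F n)) :=
  Module.Finite.equiv (balancedEval F n).quotKerEquivRange.symm

instance (n : ℕ) : Module.Finite F (multilinearGraded F (ZMod 2) n ⧸ gradedRelations F n) :=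
  Module.Finite.of_surjective (Submodule.factor (ker_balancedEval_le n))
    (Submodule.factor_surjective _)

theorem gradedCodim_le_card (n : ℕ) :
    gradedCodim (t1Grading F 2) n ≤ 4 * (balancedTuples n).card := by
  calc gradedCodim (t1Grading F 2) n
      ≤ Module.finrank F (multilinearGraded F (ZMod 2) n ⧸ LinearMap.ker (balancedEval F n)) :=
        LinearMap.finrank_le_finrank_of_surjective (f := Submodule.factor (ker_balancedEval_le n))
          (Submodule.factor_surjective _)
    _ = Module.finrank F (LinearMap.range (balancedEval F n)) :=
        (balancedEval F n).quotKerEquivRange.finrank_eq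
    _ ≤ Module.finrank F (balancedTuples n × Fin 2 × Fin 2 → F) := Submodule.finrank_le _
    _ = 4 * (balancedTuples n).card := by
        rw [Module.finrank_fintype_fun_eq_card]
        simp [mul_comm]

theorem sum_zpow_weight_pow {z : ℝ} (hz : z ≠ 0) (n : ℕ) :
    (4 + 2 * z⁻¹ + z) ^ n = ∑ r : Fin n → GradedUnit, z ^ (∑ i, (r i).weight) := by
  have h1 : ∑ x : GradedUnit, z ^ x.weight = 4 + 2 * z⁻¹ + z := by
    refine (GradedUnit.sum_eq fun (_ : ZMod 2) (p q : Fin 2) =>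
      z ^ (((p : ℕ) : ℤ) - ((q : ℕ) : ℤ))).trans ?_
    simp
    ring
  rw [← h1, Finset.sum_pow', Fintype.piFinset_univ]
  refine Finset.sum_congr rfl fun r _ => ?_
  induction (Finset.univ : Finset (Fin n)) using Finset.induction_on with
  | empty => simp
  | insert i s hi ih => rw [Finset.prod_insert hi, Finset.sum_insert hi, zpow_add₀ hz, ih]

/-- Evaluate the generating function at its minimizer √2 > 1: a tuple of weight at least -1
contributes at least 1/√2 ≥ 1/2. -/
theorem card_balancedTuples_le (n : ℕ) :
    ((balancedTuples n).card : ℝ) ≤ 2 * (4 + 2 * √2) ^ n := by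
  have hs : (0 : ℝ) < √2 := by positivity
  have hsq : √2 * √2 = (2 : ℝ) := Real.mul_self_sqrt (by norm_num)
  have hs1 : (1 : ℝ) ≤ √2 := by nlinarith
  have hs2 : √2 ≤ (2 : ℝ) := by nlinarith
  have hinv : 2 * (√2 : ℝ)⁻¹ = √2 := by
    rw [← div_eq_mul_inv, div_eq_iff hs.ne', hsq]
  have h := sum_zpow_weight_pow hs.ne' n
  rw [hinv, show 4 + √2 + √2 = 4 + 2 * √2 by ring] at h
  rw [h]
  have h2 : ∀ r ∈ balancedTuples n, (2 : ℝ)⁻¹ ≤ √2 ^ (∑ i, (r i).weight) := by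
    intro r hr
    rw [balancedTuples, Finset.mem_filter] at hr
    calc (2 : ℝ)⁻¹ ≤ √2 ^ (-1 : ℤ) := by
          rw [zpow_neg_one]; exact inv_anti₀ hs hs2
      _ ≤ _ := zpow_le_zpow_right₀ hs1 hr.2.2
  have h3 := Finset.card_nsmul_le_sum _ _ _ h2
  rw [nsmul_eq_mul] at h3
  have h4 : ∑ r ∈ balancedTuples n, √2 ^ (∑ i, (r i).weight) ≤
      ∑ r : Fin n → GradedUnit, (√2 : ℝ) ^ (∑ i, (r i).weight) :=
    Finset.sum_le_sum_of_subset_of_nonneg (Finset.subset_univ _) fun r _ _ => by positivity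
  linarith

theorem gradedCodim_le (n : ℕ) :
    (gradedCodim (t1Grading F 2) n : ℝ) ≤ 8 * (4 + 2 * √2) ^ n := by
  have h : (gradedCodim (t1Grading F 2) n : ℝ) ≤ 4 * (balancedTuples n).card :=
    mod_cast gradedCodim_le_card n
  linarith [card_balancedTuples_le n]

end UpperBound

/-! ### Fragments and the recurrence for their number -/

section Fragments

variable {n : ℕ}

/-- Consecutive letters of a word along which the matrix units `r` compose, the intermediate index
being `0` at ascents and `1` at descents. -/
def Linked (r : Fin n → GradedUnit) (x y : Fin n) : Prop :=
  (r x).col = (r y).row ∧ ((r x).col = 0 ↔ x < y)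

/-- A nonempty word whose consecutive letters are linked, which starts at the index `1` and ends at
the index `0`. -/
structure IsFragment (r : Fin n → GradedUnit) (l : List (Fin n)) : Prop where
  ne_nil : l ≠ []
  isChain : l.IsChain (Linked r)
  head : ∀ x ∈ l.head?, (r x).row = 1
  last : ∀ x ∈ l.getLast?, (r x).col = 0

/-- Tuples of matrix units for which the set of all letters splits into `h + 1` fragments. -/
def fragmentTuples (n h : ℕ) : Set (Fin n → GradedUnit) :=
  {r | ∃ L : List (List (Fin n)), L.length = h + 1 ∧ L.flatten.Perm (List.finRange n) ∧
    ∀ l ∈ L, IsFragment r l}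

/-- The tuple `r` with the letter `x` appended. -/
abbrev snocUnit (r : Fin n → GradedUnit) (x : GradedUnit) : Fin (n + 1) → GradedUnit :=
  Fin.snoc (α := fun _ => GradedUnit) r x

theorem IsFragment.castSucc {r : Fin n → GradedUnit} {l : List (Fin n)} (h : IsFragment r l)
    (x : GradedUnit) : IsFragment (snocUnit r x) (l.map Fin.castSucc) where
  ne_nil := by simpa using h.ne_nil
  isChain := by
    rw [List.isChain_map]
    refine h.isChain.imp fun a b hab => ?_
    simpa [Linked] using hab
  head := by
    intro y hy
    rw [List.head?_map] at hy
    obtain ⟨z, hz, rfl⟩ := Option.mem_map.1 hy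
    simpa using h.head z hz
  last := by
    intro y hy
    rw [List.getLast?_map] at hy
    obtain ⟨z, hz, rfl⟩ := Option.mem_map.1 hy
    simpa using h.last z hz

/-- The new letter exceeds all others, so it is reached by an ascent and left by a descent. The
linking rule then asks for index 0 before it and 1 after it, which is how fragments end and begin.
-/
theorem IsFragment.join {r : Fin n → GradedUnit} {x : GradedUnit} {l₁ l₂ : List (Fin n)}
    (h₁ : (l₁ = [] ∧ x.row = 1) ∨ (IsFragment r l₁ ∧ x.row = 0))
    (h₂ : (l₂ = [] ∧ x.col = 0) ∨ (IsFragment r l₂ ∧ x.col = 1)) :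
    IsFragment (snocUnit r x) (l₁.map Fin.castSucc ++ Fin.last n :: l₂.map Fin.castSucc) := by
  have key : ∀ l : List (Fin n), ∀ y ∈ (l.map Fin.castSucc), y < Fin.last n := by
    intro l y hy
    obtain ⟨z, -, rfl⟩ := List.mem_map.1 hy
    exact Fin.castSucc_lt_last z
  have hc : (Fin.last n :: l₂.map Fin.castSucc).IsChain (Linked (snocUnit r x)) ∧
      ∀ y ∈ (Fin.last n :: l₂.map Fin.castSucc).getLast?, (snocUnit r x y).col = 0 := by
    rcases h₂ with ⟨rfl, hx⟩ | ⟨hf, hx⟩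
    · simpa using hx
    · have hf' := hf.castSucc x
      constructor
      · rw [List.isChain_cons]
        refine ⟨fun y hy => ?_, hf'.isChain⟩
        have h1 := hf'.head y hy
        have h2 := key l₂ y (List.mem_of_mem_head? hy)
        refine ⟨by simp [hx, h1], ?_⟩
        simp [hx, h2.le]
      · intro y hy
        rw [List.getLast?_cons_of_ne_nil hf'.ne_nil] at hy
        exact hf'.last y hy
  refine ⟨by simp, ?_, ?_, ?_⟩
  · rw [List.isChain_append]
    rcases h₁ with ⟨rfl, hx⟩ | ⟨hf, hx⟩
    · simpa using hc.1
    · have hf' := hf.castSucc x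
      refine ⟨hf'.isChain, hc.1, fun y hy z hz => ?_⟩
      obtain rfl : Fin.last n = z := by simpa using hz
      have h1 := hf'.last y hy
      have h2 := key l₁ y (List.mem_of_mem_getLast? hy)
      exact ⟨by simp [hx, h1], by simp [h1, h2]⟩
  · rcases h₁ with ⟨rfl, hx⟩ | ⟨hf, hx⟩
    · simpa using hx
    · have hf' := hf.castSucc x
      rw [List.head?_append_of_ne_nil _ hf'.ne_nil]
      exact hf'.head
  · rw [List.getLast?_append_of_ne_nil _ (by simp)]
    exact hc.2

theorem snocUnit_mem_fragmentTuples_of_join {r : Fin n → GradedUnit} {x : GradedUnit}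
    {l₁ l₂ : List (Fin n)} {L : List (List (Fin n))}
    (h₁ : (l₁ = [] ∧ x.row = 1) ∨ (IsFragment r l₁ ∧ x.row = 0))
    (h₂ : (l₂ = [] ∧ x.col = 0) ∨ (IsFragment r l₂ ∧ x.col = 1))
    (hL : (l₁ ++ l₂ ++ L.flatten).Perm (List.finRange n)) (hr : ∀ l ∈ L, IsFragment r l) :
    snocUnit r x ∈ fragmentTuples (n + 1) L.length := by
  refine ⟨(l₁.map Fin.castSucc ++ Fin.last n :: l₂.map Fin.castSucc) :: L.map (List.map Fin.castSucc),
    by simp, ?_, ?_⟩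
  · rw [List.finRange_succ_last]
    have h := (hL.map Fin.castSucc).append_right [Fin.last n]
    refine List.Perm.trans ?_ h
    rw [List.flatten_cons, ← List.map_flatten, List.map_append, List.map_append, List.append_assoc,
      List.append_assoc, List.append_assoc]
    refine List.Perm.append_left _ ?_
    rw [List.cons_append, ← List.append_assoc]
    exact (List.perm_append_singleton _ _).symm
  · intro l hl
    rcases List.mem_cons.1 hl with rfl | hl
    · exact IsFragment.join h₁ h₂
    · obtain ⟨l', hl', rfl⟩ := List.mem_map.1 hl
      exact (hr l' hl').castSucc x

/-- A letter with row 0 is attached to the end of a fragment, and one with column 1 to the beginning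
of a fragment; otherwise that side stays free. Thus e_{01} merges two fragments, e_{10} starts a new
one, and the diagonal units extend one. -/
theorem snocUnit_mem_fragmentTuples {r : Fin n → GradedUnit} {x : GradedUnit} {k h : ℕ}
    (hr : r ∈ fragmentTuples n k) (hk : (k : ℤ) + x.weight = h) :
    snocUnit r x ∈ fragmentTuples (n + 1) h := by
  obtain ⟨L, hlen, hperm, hfrag⟩ := hr
  have h2 : ∀ p : Fin 2, p = 0 ∨ p = 1 := by decide
  rcases L with _ | ⟨l, L⟩
  · simp at hlen
  have hl := hfrag l (by simp)
  have hL : ∀ l ∈ L, IsFragment r l := fun l' h' => hfrag l' (by simp [h'])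
  rcases h2 x.row with hp | hp <;> rcases h2 x.col with hq | hq <;>
    simp only [GradedUnit.weight, hp, hq] at hk <;> simp at hk hlen
  · obtain rfl : L.length = h := by omega
    exact snocUnit_mem_fragmentTuples_of_join (.inr ⟨hl, hp⟩) (.inl ⟨rfl, hq⟩) (by simpa using hperm) hL
  -- With only one fragment, k = 0 and weight -1 would make h negative.
  · rcases L with _ | ⟨l', L⟩
    · simp at hlen; omega
    obtain rfl : L.length = h := by simp at hlen; omega
    exact snocUnit_mem_fragmentTuples_of_join (.inr ⟨hl, hp⟩) (.inr ⟨hL l' (by simp), hq⟩)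
      (by simpa using hperm) fun a ha => hL a (by simp [ha])
  · obtain rfl : (l :: L).length = h := by simp; omega
    exact snocUnit_mem_fragmentTuples_of_join (.inl ⟨rfl, hp⟩) (.inl ⟨rfl, hq⟩) (by simpa using hperm) hfrag
  · obtain rfl : L.length = h := by omega
    exact snocUnit_mem_fragmentTuples_of_join (.inl ⟨rfl, hp⟩) (.inr ⟨hl, hq⟩) (by simpa using hperm) hL

theorem fragmentTuples_one_zero_nonempty : (fragmentTuples 1 0).Nonempty := by
  refine ⟨fun _ => ⟨(0, 1, 0), .inl rfl⟩, [[0]], rfl, by simp [List.finRange], ?_⟩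
  intro l hl
  obtain rfl := List.mem_singleton.1 hl
  exact ⟨by simp, by simp, fun _ _ => rfl, fun _ _ => rfl⟩

/-- The tuples to which a letter of weight `d` may be appended to obtain `h + 1` fragments. -/
def fragmentTuplesBefore (n : ℕ) (h d : ℤ) : Set (Fin n → GradedUnit) :=
  {r | ∃ k : ℕ, r ∈ fragmentTuples n k ∧ k + d = h}

theorem fragmentTuplesBefore_eq {k : ℕ} {h d : ℤ} (hk : k + d = h) :
    fragmentTuplesBefore n h d = fragmentTuples n k := by
  ext r
  refine ⟨?_, fun hr => ⟨k, hr, hk⟩⟩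
  rintro ⟨k', hr, hk'⟩
  obtain rfl : k' = k := by omega
  exact hr

/-- Appending a letter is injective in the pair of tuple and letter. For h = 0 the term with d = 1
counts the empty set, so the boundary case needs no separate statement. -/
theorem ncard_fragmentTuples_succ (n h : ℕ) :
    4 * (fragmentTuples n h).ncard + 2 * (fragmentTuples n (h + 1)).ncard +
      (fragmentTuplesBefore n h 1).ncard ≤ (fragmentTuples (n + 1) h).ncard := by
  classical
  have hsum : ∑ x : GradedUnit, (fragmentTuplesBefore n h x.weight).ncard =
      4 * (fragmentTuples n h).ncard + 2 * (fragmentTuples n (h + 1)).ncard +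
      (fragmentTuplesBefore n h 1).ncard := by
    refine (GradedUnit.sum_eq fun (_ : ZMod 2) (p q : Fin 2) =>
      (fragmentTuplesBefore n h (((p : ℕ) : ℤ) - ((q : ℕ) : ℤ))).ncard).trans ?_
    have h0 := fragmentTuplesBefore_eq (n := n) (k := h) (h := h) (d := 0) (by simp)
    have h1 := fragmentTuplesBefore_eq (n := n) (k := h + 1) (h := h) (d := -1) (by push_cast; ring)
    simp [h0, h1]
    ring
  rw [← hsum]
  have hs : ∀ s : Set (Fin n → GradedUnit), s.ncard = s.toFinset.card := fun s =>
    Set.ncard_eq_toFinset_card' s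
  simp only [hs]
  rw [← Finset.card_sigma, Set.ncard_eq_toFinset_card']
  refine Finset.card_le_card_of_injOn (fun y => snocUnit y.2 y.1) ?_ ?_
  · rintro ⟨x, r⟩ hr
    simp only [Finset.coe_sigma, Set.mem_sigma_iff, Finset.mem_coe, Set.mem_toFinset] at hr ⊢
    obtain ⟨k, hk, hk'⟩ := hr.2
    exact snocUnit_mem_fragmentTuples hk hk'
  · rintro ⟨x, r⟩ - ⟨y, s⟩ - hxy
    obtain ⟨rfl, rfl⟩ := Fin.snoc_injective2 hxy
    rfl

end Fragments

/-! ### Independence of fragment monomials -/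

section Triangularity

variable {n : ℕ}

/-- In a vanishing combination, take j of largest Φ among the nonzero coefficients: φ j annihilates
every other term. -/
theorem linearIndependent_of_triangular {F V ι : Type*} [Field F] [AddCommGroup V] [Module F V]
    (v : ι → V) (φ : ι → V →ₗ[F] F) (Φ : ι → ℤ) (h1 : ∀ i, φ i (v i) ≠ 0)
    (h2 : ∀ i j, φ j (v i) ≠ 0 → Φ j ≤ Φ i ∧ (Φ j = Φ i → j = i)) : LinearIndependent F v := by
  rw [linearIndependent_iff']
  intro s c hc
  by_contra! hne
  classical
  obtain ⟨i, his, hci⟩ := hne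
  obtain ⟨j, hj, hmax⟩ := (s.filter fun i => c i ≠ 0).exists_max_image Φ
    ⟨i, Finset.mem_filter.2 ⟨his, hci⟩⟩
  rw [Finset.mem_filter] at hj
  have h := congrArg (φ j) hc
  rw [map_sum, map_zero, Finset.sum_eq_single j] at h
  · rw [map_smul, smul_eq_mul] at h
    exact mul_ne_zero hj.2 (h1 j) h
  · intro k hk hkj
    rw [map_smul, smul_eq_mul]
    by_contra hne
    have hk2 := h2 k j (right_ne_zero_of_mul hne)
    have := hmax k (Finset.mem_filter.2 ⟨hk, left_ne_zero_of_mul hne⟩)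
    exact hkj (hk2.2 (le_antisymm hk2.1 this)).symm
  · exact fun h => absurd hj.1 h

/-- The summand of `tuplePotential` at a position. -/
def unitPotential (r : Fin n → GradedUnit) (i : Fin n) : ℤ :=
  (if (r i).row = 0 then (i : ℤ) else 0) - if (r i).col = 0 then (i : ℤ) else 0

/-- The statistic with respect to which evaluations of words are triangular. -/
def tuplePotential (r : Fin n → GradedUnit) : ℤ := ∑ i, unitPotential r i

/-- A junction from x to y contributes y - x if its index is 0, and nothing if it is 1. Linked words
realize the larger of the two at every junction. The row term of the first letter is subtracted
because it belongs to the junction before it. -/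
theorem potential_le_of_isChain {r s : Fin n → GradedUnit} (x : Fin n) (l : List (Fin n))
    (hnd : (x :: l).Nodup) (hr : (x :: l).IsChain (Linked r)) (hr' : ∀ y ∈ (x :: l).getLast?, (r y).col = 0)
    (hs : (x :: l).IsChain fun a b => (s a).col = (s b).row)
    (hs' : ∀ y ∈ (x :: l).getLast?, (s y).col = 0) :
    ((x :: l).map (unitPotential s)).sum - (if (s x).row = 0 then (x : ℤ) else 0) ≤
        ((x :: l).map (unitPotential r)).sum - (if (r x).row = 0 then (x : ℤ) else 0) ∧
      (((x :: l).map (unitPotential s)).sum - (if (s x).row = 0 then (x : ℤ) else 0) =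
        ((x :: l).map (unitPotential r)).sum - (if (r x).row = 0 then (x : ℤ) else 0) →
        (∀ y ∈ x :: l, (s y).col = (r y).col) ∧ ∀ y ∈ l, (s y).row = (r y).row) := by
  induction l generalizing x with
  | nil =>
    have h1 := hr' x (by simp)
    have h2 := hs' x (by simp)
    simp [unitPotential, h1, h2]
  | cons y l ih =>
    rw [List.isChain_cons_cons] at hr hs
    rw [List.getLast?_cons_cons] at hr' hs'
    obtain ⟨ih1, ih2⟩ := ih y hnd.of_cons hr.2 hr' hs.2 hs'
    obtain ⟨⟨hr1, hr3⟩, -⟩ := hr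
    have hs1 := hs.1
    rw [List.map_cons (l := y :: l), List.sum_cons, List.map_cons (l := y :: l), List.sum_cons]
    generalize ((y :: l).map (unitPotential s)).sum = S at *
    generalize ((y :: l).map (unitPotential r)).sum = R at *
    simp only [unitPotential, ← hr1, ← hs1] at ih1 ih2 ⊢
    have h2 : ∀ p : Fin 2, p = 0 ∨ p = 1 := by decide
    have hxy : ((r x).col = 0 ∧ (x : ℤ) < y) ∨ ((r x).col = 1 ∧ (y : ℤ) < x) := by
      rcases h2 (r x).col with h | h
      · exact .inl ⟨h, by exact_mod_cast hr3.1 h⟩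
      · refine .inr ⟨h, ?_⟩
        rw [h] at hr3
        have hyx := not_lt.1 (fun h' => absurd (hr3.2 h') (by decide))
        -- Distinct neighbours make the two choices at a junction differ strictly; this gives
        -- uniqueness of the maximizer.
        have hne : y ≠ x := fun h' => (List.nodup_cons.1 hnd).1 (by simp [h'])
        exact_mod_cast lt_of_le_of_ne hyx hne
    have hconcl : (s x).col = (r x).col →
        ((∀ z ∈ y :: l, (s z).col = (r z).col) ∧ ∀ z ∈ l, (s z).row = (r z).row) →
        (∀ z ∈ x :: y :: l, (s z).col = (r z).col) ∧ ∀ z ∈ y :: l, (s z).row = (r z).row := by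
      rintro h ⟨ha, hb⟩
      refine ⟨List.forall_mem_cons.2 ⟨h, ha⟩, List.forall_mem_cons.2 ⟨?_, hb⟩⟩
      rw [← hs1, ← hr1, h]
    have h01 : ¬ (1 : Fin 2) = 0 := by decide
    generalize (if (s x).row = 0 then (x : ℤ) else 0) = a at *
    generalize (if (r x).row = 0 then (x : ℤ) else 0) = b at *
    rcases hxy with ⟨h, hlt⟩ | ⟨h, hlt⟩ <;> rcases h2 (s x).col with h' | h' <;>
      simp only [h, h', if_true, if_neg h01] at ih1 ih2 ⊢
    · exact ⟨by omega, fun he => hconcl (h'.trans h.symm) (ih2 (by omega))⟩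
    · exact ⟨by omega, fun he => absurd he (by omega)⟩
    · exact ⟨by omega, fun he => absurd he (by omega)⟩
    · exact ⟨by omega, fun he => hconcl (h'.trans h.symm) (ih2 (by omega))⟩

theorem tuplePotential_le {r s : Fin n → GradedUnit} {l : List (Fin n)}
    (hl : l.Perm (List.finRange n)) (hr : IsFragment r l)
    (hs : l.IsChain fun a b => (s a).col = (s b).row) (hs1 : ∀ y ∈ l.head?, (s y).row = 1)
    (hs2 : ∀ y ∈ l.getLast?, (s y).col = 0) :
    tuplePotential s ≤ tuplePotential r ∧ (tuplePotential s = tuplePotential r →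
      ∀ i, (s i).row = (r i).row ∧ (s i).col = (r i).col) := by
  have hsum : ∀ r : Fin n → GradedUnit, tuplePotential r = (l.map (unitPotential r)).sum := by
    intro r
    rw [(hl.map _).sum_eq, ← List.ofFn_eq_map, List.sum_ofFn]
    rfl
  have hmem : ∀ i, i ∈ l := fun i => hl.mem_iff.2 (List.mem_finRange i)
  rcases l with _ | ⟨x, l⟩
  · exact absurd rfl hr.ne_nil
  have h := potential_le_of_isChain x l (hl.nodup_iff.2 (List.nodup_finRange n)) hr.isChain hr.last hs hs2
  have h1 := hr.head x (by simp)
  have h2 := hs1 x (by simp)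
  have h01 : ¬ (1 : Fin 2) = 0 := by decide
  simp only [h1, h2, if_neg h01, sub_zero] at h
  rw [hsum, hsum]
  refine ⟨h.1, fun he i => ⟨?_, (h.2 he).1 i (hmem i)⟩⟩
  rcases List.mem_cons.1 (hmem i) with rfl | hi
  · rw [h1, h2]
  · exact (h.2 he).2 i hi

theorem chain_of_prod_ne_zero {F ι : Type*} [Field F] (P : ι → Prop) [DecidablePred P] (a b : ι → Fin 2)
    (x : ι) (l : List ι) {p q : Fin 2}
    (h : ((x :: l).map fun i => if P i then (Matrix.single (a i) (b i) 1 : Matrix (Fin 2) (Fin 2) F)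
      else 0).prod p q ≠ 0) :
    (∀ y ∈ x :: l, P y) ∧ a x = p ∧ (x :: l).IsChain (fun y z => b y = a z) ∧
      ∀ y ∈ (x :: l).getLast?, b y = q := by
  have hsingle : ∀ (x : ι) (p q : Fin 2), (if P x then
      (Matrix.single (a x) (b x) 1 : Matrix (Fin 2) (Fin 2) F) else 0) p q ≠ 0 →
      P x ∧ a x = p ∧ b x = q := by
    intro x p q h
    split_ifs at h with hP
    · rw [Matrix.single_apply] at h
      split_ifs at h with h1
      · exact ⟨hP, h1⟩
      · exact absurd rfl h
    · exact absurd rfl h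
  induction l generalizing x p with
  | nil =>
    rw [List.map_cons, List.map_nil, List.prod_singleton] at h
    obtain ⟨h1, h2, h3⟩ := hsingle x p q h
    simp [h1, h2, h3]
  | cons y l ih =>
    rw [List.map_cons, List.prod_cons, Matrix.mul_apply] at h
    obtain ⟨m, -, hm⟩ := Finset.exists_ne_zero_of_sum_ne_zero h
    obtain ⟨h1, h2, h3⟩ := hsingle x p m (left_ne_zero_of_mul hm)
    obtain ⟨i1, i2, i3, i4⟩ := ih y (right_ne_zero_of_mul hm)
    refine ⟨List.forall_mem_cons.2 ⟨h1, i1⟩, h2, List.isChain_cons_cons.2 ⟨h3.trans i2.symm, i3⟩, ?_⟩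
    rwa [List.getLast?_cons_cons]

theorem prod_single_eq_one {F ι : Type*} [Field F] (a b : ι → Fin 2) (x : ι) (l : List ι) {q : Fin 2}
    (hc : (x :: l).IsChain (fun y z => b y = a z)) (hq : ∀ y ∈ (x :: l).getLast?, b y = q) :
    ((x :: l).map fun i => (Matrix.single (a i) (b i) 1 : Matrix (Fin 2) (Fin 2) F)).prod (a x) q = 1 := by
  induction l generalizing x with
  | nil =>
    have := hq x (by simp)
    simp [this]
  | cons y l ih =>
    rw [List.isChain_cons_cons] at hc
    rw [List.getLast?_cons_cons] at hq
    rw [List.map_cons, List.prod_cons, Matrix.single_mul_apply_same, hc.1, ih y hc.2 hq, one_mul]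

variable (F : Type*) [Field F]

/-- The monomial spelled by a nonempty list of variables. -/
noncomputable def listMonomial (n : ℕ) (r : Fin n → GradedUnit) (l : List (Fin n)) :
    FreeGradedAlgebra F (ZMod 2) :=
  match l with
  | [] => 0
  | x :: l => MonoidAlgebra.single
      ⟨((r x).deg, (x : ℕ)), l.map fun i => ((r i).deg, (i : ℕ))⟩ 1

variable {F}

theorem listMonomial_mem {r : Fin n → GradedUnit} {l : List (Fin n)}
    (hl : l.Perm (List.finRange n)) : listMonomial F n r l ∈ multilinearGraded F (ZMod 2) n := by
  rcases l with _ | ⟨x, l⟩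
  · exact Submodule.zero_mem _
  · exact single_mem_multilinearGraded (x :: l) hl (fun i => (r i).deg) _ rfl

theorem gradedEval_listMonomial (r s : Fin n → GradedUnit) (x : Fin n) (l : List (Fin n)) :
    gradedEval (unitSubst F s) (listMonomial F n r (x :: l)) =
      ((x :: l).map fun i => if (s i).deg = (r i).deg then
        (Matrix.single (s i).row (s i).col 1 : Matrix (Fin 2) (Fin 2) F) else 0).prod := by
  rw [listMonomial, gradedEval_single]
  simp only [List.map_cons, List.map_map, unitSubst_fin, Function.comp_def]

theorem gradedEval_listMonomial_self {r : Fin n → GradedUnit} {l : List (Fin n)}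
    (hr : IsFragment r l) : gradedEval (unitSubst F r) (listMonomial F n r l) 1 0 = 1 := by
  rcases l with _ | ⟨x, l⟩
  · exact absurd rfl hr.ne_nil
  rw [gradedEval_listMonomial]
  simp only [if_true]
  rw [← hr.head x (by simp)]
  exact prod_single_eq_one _ _ x l (hr.isChain.imp fun a b h => h.1) hr.last

/-- The variables of the monomial fix the degrees of s; equality of potentials fixes its rows and
columns. -/
theorem gradedEval_listMonomial_triangular {r s : Fin n → GradedUnit} {l : List (Fin n)}
    (hl : l.Perm (List.finRange n)) (hr : IsFragment r l)
    (h : gradedEval (unitSubst F s) (listMonomial F n r l) 1 0 ≠ 0) :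
    tuplePotential s ≤ tuplePotential r ∧ (tuplePotential s = tuplePotential r → s = r) := by
  have hmem : ∀ i, i ∈ l := fun i => hl.mem_iff.2 (List.mem_finRange i)
  rcases l with _ | ⟨x, l⟩
  · exact absurd rfl hr.ne_nil
  rw [gradedEval_listMonomial] at h
  obtain ⟨h1, h2, h3, h4⟩ := chain_of_prod_ne_zero _ _ _ x l h
  have h5 := tuplePotential_le hl hr h3 (by simpa using h2) h4
  refine ⟨h5.1, fun he => ?_⟩
  funext i
  exact GradedUnit.ext_iff'.2 ⟨h1 i (hmem i), h5.2 he i⟩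

/-- An entry of the value of a multilinear polynomial modulo identities at matrix units. -/
noncomputable def codimFunctional (F : Type*) [Field F] {n : ℕ} (s : Fin n → GradedUnit) :
    (multilinearGraded F (ZMod 2) n ⧸ gradedRelations F n) →ₗ[F] F :=
  (gradedRelations F n).liftQ
    { toFun := fun f => gradedEval (unitSubst F s) f.1 1 0
      map_add' := fun f g => by simp
      map_smul' := fun c f => by simp }
    (by
      intro f hf
      have h := mem_gradedIdentities_t1Grading.1 (Submodule.mem_comap.1 hf).2 _ (unitSubst_mem s)
      exact congrFun (congrFun h 1) 0)

theorem ncard_fragmentTuples_le_gradedCodim (n : ℕ) :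
    (fragmentTuples n 0).ncard ≤ gradedCodim (t1Grading F 2) n := by
  classical
  have hex : ∀ r : fragmentTuples n 0, ∃ l : List (Fin n), l.Perm (List.finRange n) ∧
      IsFragment r.1 l := by
    rintro ⟨r, L, hL, hperm, hfrag⟩
    obtain ⟨l, rfl⟩ := List.length_eq_one_iff.1 hL
    exact ⟨l, by simpa using hperm, hfrag l (by simp)⟩
  -- Any admissible word will do, since triangularity compares tuples rather than words.
  choose l hperm hfrag using hex
  have hli := linearIndependent_of_triangular
    (fun r : fragmentTuples n 0 => (gradedRelations F n).mkQ
      ⟨listMonomial F n r.1 (l r), listMonomial_mem (hperm r)⟩)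
    (fun s => codimFunctional F s.1) (fun r => tuplePotential r.1)
    (fun r => by
      have h := gradedEval_listMonomial_self (F := F) (hfrag r)
      intro h0
      exact one_ne_zero (h.symm.trans h0))
    (fun r s h => by
      have h' := gradedEval_listMonomial_triangular (F := F) (s := s.1) (hperm r) (hfrag r) h
      exact ⟨h'.1, fun he => Subtype.ext (h'.2 he)⟩)
  have h := hli.fintype_card_le_finrank
  rwa [← Nat.card_eq_fintype_card, Nat.card_coe_set_eq] at h

end Triangularity

/-! ### Growth of the recurrence and the limit -/

section Growth

/-- The vector (√2)^{-h} sin((h+1)θ) is an eigenvector of the recurrence on 0 ≤ h ≤ K vanishing at h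
= -1 and h = K + 1; the factor (√2)^{-h} symmetrizes the weights 2 and 1. The start K + 1 is late
enough for every s n h with h ≤ K to have reached 1. -/
theorem pow_mul_le_of_recurrence (s : ℕ → ℕ → ℝ) (hs : ∀ n h, 0 ≤ s n h) (h1 : 1 ≤ s 1 0)
    (hrec0 : ∀ n, 4 * s n 0 + 2 * s n 1 ≤ s (n + 1) 0)
    (hrec : ∀ n h, 4 * s n (h + 1) + 2 * s n (h + 2) + s n h ≤ s (n + 1) (h + 1))
    (K : ℕ) (θ : ℝ) (hθ : θ = Real.pi / (K + 2)) (m : ℕ) :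
    ∀ h ≤ K, (4 + 2 * √2 * Real.cos θ) ^ m * ((√2)⁻¹ ^ h * Real.sin ((h + 1) * θ)) ≤
      s (K + 1 + m) h := by
  have hr : (0 : ℝ) < √2 := by positivity
  have hr1 : (1 : ℝ) ≤ √2 := Real.one_le_sqrt.2 (by norm_num)
  have hr2 : 2 * (√2)⁻¹ = (√2 : ℝ) := by
    rw [← div_eq_mul_inv, div_eq_iff hr.ne', Real.mul_self_sqrt (by norm_num)]
  have hmono : ∀ n h, s n h ≤ s (n + 1) h := by
    intro n h
    cases h with
    | zero => linarith [hrec0 n, hs n 0, hs n 1]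
    | succ h => linarith [hrec n h, hs n (h + 1), hs n (h + 2), hs n h]
  have hdiag : ∀ h, 1 ≤ s (h + 1) h := by
    intro h
    induction h with
    | zero => exact h1
    | succ h ih => linarith [hrec (h + 1) h, hs (h + 1) (h + 1), hs (h + 1) (h + 2)]
  have hK : (0 : ℝ) < K + 2 := by positivity
  have hθ0 : 0 < θ := by rw [hθ]; exact div_pos Real.pi_pos hK
  have hθK : (K + 2) * θ = Real.pi := by rw [hθ]; field_simp
  have hθ2 : θ ≤ Real.pi / 2 := by
    have : (0 : ℝ) ≤ K := Nat.cast_nonneg K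
    nlinarith
  have hcos : 0 ≤ Real.cos θ := Real.cos_nonneg_of_neg_pi_div_two_le_of_le (by linarith) hθ2
  set c := 4 + 2 * √2 * Real.cos θ with hc
  have hc0 : 0 ≤ c := by positivity
  have htrig : ∀ x : ℝ, Real.sin ((x + 1 + 1) * θ) + Real.sin (x * θ) =
      2 * Real.cos θ * Real.sin ((x + 1) * θ) := by
    intro x
    rw [show (x + 1 + 1) * θ = (x + 1) * θ + θ by ring, show x * θ = (x + 1) * θ - θ by ring,
      Real.sin_add, Real.sin_sub]
    ring
  induction m with
  | zero =>
    intro h hh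
    have hge : 1 ≤ s (K + 1) h :=
      (hdiag h).trans (monotone_nat_of_le_succ (fun n => hmono n h) (by omega))
    have h2 : (√2)⁻¹ ^ h ≤ (1 : ℝ) := pow_le_one₀ (by positivity) (inv_le_one_of_one_le₀ hr1)
    have h3 : (√2)⁻¹ ^ h * Real.sin ((h + 1) * θ) ≤ (√2)⁻¹ ^ h * 1 :=
      mul_le_mul_of_nonneg_left (Real.sin_le_one _) (by positivity)
    simp only [pow_zero, one_mul, add_zero]
    linarith
  | succ m ih =>
    have ih' : ∀ h ≤ K + 1, c ^ m * ((√2)⁻¹ ^ h * Real.sin ((h + 1) * θ)) ≤ s (K + 1 + m) h := by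
      intro h hh
      rcases Nat.lt_or_ge K h with hlt | hge
      · obtain rfl : h = K + 1 := by omega
        have : (((K + 1 : ℕ) : ℝ) + 1) * θ = Real.pi := by rw [← hθK]; push_cast; ring
        rw [this, Real.sin_pi, mul_zero, mul_zero]
        exact hs _ _
      · exact ih h hge
    intro h hh
    rw [← add_assoc]
    cases h with
    | zero =>
      have a0 := ih' 0 (by omega)
      have a1 := ih' 1 (by omega)
      have ht := htrig 0
      simp only [zero_add, one_mul, zero_mul, Real.sin_zero, add_zero, pow_zero, pow_one,
        Nat.cast_zero, Nat.cast_one] at a0 a1 ht ⊢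
      refine le_trans (le_of_eq ?_) (hrec0 _ |>.trans' (add_le_add
        (mul_le_mul_of_nonneg_left a0 (by norm_num : (0 : ℝ) ≤ 4))
        (mul_le_mul_of_nonneg_left a1 (by norm_num : (0 : ℝ) ≤ 2))))
      rw [ht, pow_succ]
      linear_combination (c ^ m * Real.sin θ) * hc - 2 * c ^ m * Real.cos θ * Real.sin θ * hr2
    | succ h =>
      have a0 := ih' h (by omega)
      have a1 := ih' (h + 1) (by omega)
      have a2 := ih' (h + 2) (by omega)
      have ht := htrig (h + 1)
      push_cast at a0 a1 a2 ⊢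
      rw [show (h : ℝ) + 2 + 1 = h + 1 + 1 + 1 by ring] at a2
      refine le_trans (le_of_eq ?_) (hrec _ h |>.trans' (add_le_add (add_le_add
        (mul_le_mul_of_nonneg_left a1 (by norm_num : (0 : ℝ) ≤ 4))
        (mul_le_mul_of_nonneg_left a2 (by norm_num : (0 : ℝ) ≤ 2))) a0))
      have hinv : √2 * (√2)⁻¹ = (1 : ℝ) := mul_inv_cancel₀ hr.ne'
      generalize (√2)⁻¹ = i at *
      generalize Real.sin ((h + 1 + 1 + 1) * θ) = A at *
      generalize Real.sin ((h + 1 + 1) * θ) = B at *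
      generalize Real.sin ((h + 1) * θ) = D at *
      have hi2 : 2 * i * i = 1 := by rw [hr2, hinv]
      obtain rfl : A = 2 * Real.cos θ * B - D := by linarith
      rw [pow_succ c, pow_succ i (h + 1), pow_succ i h]
      linear_combination (c ^ m * (i ^ h * i * B)) * hc
        - (c ^ m * i ^ h * i * 2 * Real.cos θ * B) * hr2 + c ^ m * i ^ h * D * hi2

theorem tendsto_rpow_inv_of_le_of_le {u : ℕ → ℝ} {L C : ℝ} (hL : 0 < L) (hC : 0 < C)
    (hupper : ∀ n, u n ≤ C * L ^ n)
    (hlower : ∀ a < L, ∃ b, a < b ∧ 0 < b ∧ ∃ c : ℝ, 0 < c ∧ ∀ᶠ n in atTop, c * b ^ n ≤ u n) :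
    Tendsto (fun n : ℕ => u n ^ (1 / (n : ℝ))) atTop (𝓝 L) := by
  have hlim : ∀ c b : ℝ, 0 < c → 0 < b →
      Tendsto (fun n : ℕ => (c * b ^ n) ^ (1 / (n : ℝ))) atTop (𝓝 b) := by
    intro c b hc hb
    have h1 : Tendsto (fun n : ℕ => c ^ (1 / (n : ℝ)) * b) atTop (𝓝 (c ^ (0 : ℝ) * b)) :=
      ((Real.continuousAt_const_rpow hc.ne').tendsto.comp
        tendsto_one_div_atTop_nhds_zero_nat).mul_const b
    rw [Real.rpow_zero, one_mul] at h1
    refine h1.congr' ?_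
    filter_upwards [eventually_gt_atTop 0] with n hn
    rw [Real.mul_rpow hc.le (by positivity), one_div, Real.pow_rpow_inv_natCast hb.le hn.ne']
  rw [tendsto_order]
  constructor
  · intro a ha
    obtain ⟨b, hab, hb, c, hc, hle⟩ := hlower a ha
    filter_upwards [hle, (hlim c b hc hb).eventually (lt_mem_nhds hab)] with n h1 h2
    exact h2.trans_le (Real.rpow_le_rpow (by positivity) h1 (by positivity))
  · intro a ha
    -- Only used to make u n eventually nonnegative, as monotonicity of the real power requires.
    obtain ⟨b, hab, hb, c, hc, hle⟩ := hlower 0 hL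
    filter_upwards [hle, (hlim C L hC hL).eventually (gt_mem_nhds ha)] with n h1 h2
    exact (Real.rpow_le_rpow (le_trans (by positivity) h1) (hupper n) (by positivity)).trans_lt h2

theorem exists_le_ncard_fragmentTuples {a : ℝ} (ha : a < 4 + 2 * √2) :
    ∃ b, a < b ∧ 0 < b ∧ ∃ c : ℝ, 0 < c ∧
      ∀ᶠ n : ℕ in atTop, c * b ^ n ≤ (fragmentTuples n 0).ncard := by
  have hlim : Tendsto (fun K : ℕ => 4 + 2 * √2 * Real.cos (Real.pi / ((K : ℝ) + 2))) atTop
      (𝓝 (4 + 2 * √2 * Real.cos 0)) := by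
    refine (Real.continuous_cos.continuousAt.tendsto.comp ?_).const_mul _ |>.const_add _
    exact tendsto_const_nhds.div_atTop
      (tendsto_atTop_add_const_right _ _ tendsto_natCast_atTop_atTop)
  rw [Real.cos_zero, mul_one] at hlim
  obtain ⟨K, hK, hK0⟩ := ((hlim.eventually (lt_mem_nhds ha)).and
    (hlim.eventually (lt_mem_nhds (by positivity : (0 : ℝ) < 4 + 2 * √2)))).exists
  set b := 4 + 2 * √2 * Real.cos (Real.pi / ((K : ℝ) + 2)) with hb
  have hsin : 0 < Real.sin (Real.pi / ((K : ℝ) + 2)) := by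
    apply Real.sin_pos_of_pos_of_lt_pi (by positivity)
    exact div_lt_self Real.pi_pos (by have : (0 : ℝ) ≤ K := Nat.cast_nonneg K; linarith)
  refine ⟨b, hK, hK0, Real.sin (Real.pi / ((K : ℝ) + 2)) / b ^ (K + 1), by positivity, ?_⟩
  filter_upwards [eventually_ge_atTop (K + 1)] with n hn
  obtain ⟨m, rfl⟩ := Nat.exists_eq_add_of_le hn
  have h := pow_mul_le_of_recurrence (fun n h => ((fragmentTuples n h).ncard : ℝ))
    (fun _ _ => Nat.cast_nonneg _)
    (by
      have : 0 < (fragmentTuples 1 0).ncard :=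
        (Set.ncard_pos (Set.toFinite _)).2 fragmentTuples_one_zero_nonempty
      exact_mod_cast this)
    (fun n => by
      have := ncard_fragmentTuples_succ n 0
      have h' : 4 * (fragmentTuples n 0).ncard + 2 * (fragmentTuples n 1).ncard ≤
          (fragmentTuples (n + 1) 0).ncard := le_trans (Nat.le_add_right _ _) this
      exact_mod_cast h')
    (fun n h => by
      have := ncard_fragmentTuples_succ n (h + 1)
      rw [fragmentTuplesBefore_eq (k := h) (by push_cast; ring)] at this
      exact_mod_cast this)
    K _ rfl m 0 (Nat.zero_le _)
  simp only [pow_zero, one_mul, Nat.cast_zero, zero_add] at h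
  rw [pow_add b (K + 1), ← mul_assoc, div_mul_cancel₀ _ (by positivity), mul_comm]
  exact h

end Growth

theorem mainTheorem2 (F : Type*) [Field F] [CharZero F] :
    Tendsto (fun n : ℕ => (gradedCodim (t1Grading F 2) n : ℝ) ^ (1 / (n : ℝ))) atTop
      (𝓝 (4 + 2 * Real.sqrt 2)) := by
  refine tendsto_rpow_inv_of_le_of_le (by positivity) (by norm_num : (0 : ℝ) < 8) gradedCodim_le ?_
  intro a ha
  obtain ⟨b, hab, hb, c, hc, hle⟩ := exists_le_ncard_fragmentTuples ha
  refine ⟨b, hab, hb, c, hc, hle.mono fun n hn => hn.trans ?_⟩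
  exact_mod_cast ncard_fragmentTuples_le_gradedCodim n
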